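/- Let $A,B,C$ be quantum registers of dimensions $d_A\ge 1$, $d_B=2^k$ (so $B$ consists of the $k\ge 1$ qubits whose wires are cut) and $d_C\ge 1$. A task is a pair $T=(U_2,f)$ of a unitary $U_2$ on $\mathcal H_B\otimes\mathcal H_C$ and a function $f$ with values in $[-1,1]$ on the standard basis of $\mathcal H_A\otimes\mathcal H_B\otimes\mathcal H_C$; put $O_f=\sum_z f(z)|z\rangle\langle z|$. A wire-cutting procedure consists of a discrete POVM $\{M_y\}$ on $\mathcal H_B$ that does not depend on the task and, for every task $T$, of states $\tau_y$ of $B$, a number of rounds $N_T$ and a real-valued estimator. Given a task $T$ and $N_T$ copies of an unknown state $\rho\otimes\sigma$, with $\rho$ a state of $(A,B)$ and $\sigma$ a state of $C$, it does the following independently with each copy: it measures $\{M_y\}$ on $B$; on outcome $y$ it prepares $B$ in the state $\tau_y$; it applies $U_2$ to $(B,C)$; and it measures all registers in the standard basis, with outcome $z$. It then outputs the value of the estimator on the $N_T$ pairs $(y,z)$. The procedure succeeds with accuracy $\varepsilon$ and probability $p$ if, for every task $T$ and all states $\rho,\sigma$, with probability at least $p$ the output differs by at most $\varepsilon$ from $\operatorname{Tr}\bigl(O_f\,(\mathbb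 1_A\otimes U_2)(\rho\otimes\sigma)(\mathbb 1_A\otimes U_2)^\dagger\bigr)$. Theorem. For every $p>1/2$ there is a constant $c>0$, depending only on $p$, such that for all $k,d_A,d_C\ge 1$ and all $0<\varepsilon<1$, every wire-cutting procedure that succeeds with accuracy $\varepsilon$ and probability $p$ satisfies $N_T\ge c\,2^k/\varepsilon^2$ for some task $T$. That is, wire cutting needs $\Omega(2^k/\varepsilon^2)$ samples in the worst case. -/

import Mathlib

open scoped Kronecker ComplexOrder

noncomputable section

namespace WireCutting

/-- Quantum states: positive semidefinite operators of unit trace. -/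
def IsState {n : Type*} [Fintype n] (ρ : Matrix n n ℂ) : Prop :=
  ρ.PosSemidef ∧ ρ.trace = 1

/-- The partial trace over the second tensor factor. -/
def traceRight {m n : Type*} [Fintype n] (X : Matrix (m × n) (m × n) ℂ) : Matrix m m ℂ :=
  Matrix.of fun a a' => ∑ b, X (a, b) (a', b)

/-- What is handed to a procedure that cuts the register `B`: a unitary on the registers
`(B, C)`, and a function `f` with values in `[-1, 1]` on the standard basis of `(A, B, C)`,
which gives the diagonal observable `∑ z, f z |z⟩⟨z|` of norm at most one. -/
structure Task (A B C : Type*) [Fintype B] [Fintype C] [DecidableEq B] [DecidableEq C] where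
  unitary : Matrix.unitaryGroup (B × C) ℂ
  f : A × B × C → ℝ
  abs_f_le : ∀ z, |f z| ≤ 1

section

variable {A B C : Type*} [Fintype A] [Fintype B] [Fintype C]
  [DecidableEq A] [DecidableEq B] [DecidableEq C]

/-- The quantity to be estimated: the expectation of the diagonal observable in the state
obtained from `ρ ⊗ σ` (`ρ` a state of `(A, B)`, `σ` a state of `C`) by applying the unitary
of the task to `(B, C)`. -/
def Task.value (T : Task A B C) (ρ : Matrix (A × B) (A × B) ℂ) (σ : Matrix C C ℂ) : ℝ :=
  (Matrix.trace (Matrix.diagonal (fun z => (T.f z : ℂ)) *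
    (((1 : Matrix A A ℂ) ⊗ₖ (T.unitary : Matrix (B × C) (B × C) ℂ)) *
      Matrix.reindex (Equiv.prodAssoc A B C) (Equiv.prodAssoc A B C) (ρ ⊗ₖ σ) *
      ((1 : Matrix A A ℂ) ⊗ₖ (T.unitary : Matrix (B × C) (B × C) ℂ)).conjTranspose))).re

end

/-- A wire-cutting procedure for the register `B`, with measurement outcomes in `Y`.
The POVM on `B` is fixed: it does not depend on the task.
The preparations, the number of rounds and the final classical estimate may depend on the task.
The estimate may use the outcomes `y` on the cut register and the final outcomes `z` of all
rounds. Classical randomness shared between the measurement, the preparation and the estimate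
is covered, since it can be made part of the outcome `y`. -/
structure Procedure (A B C Y : Type*) [Fintype B] [Fintype C]
    [DecidableEq B] [DecidableEq C] where
  effect : Y → Matrix B B ℂ
  effect_posSemidef : ∀ y, (effect y).PosSemidef
  effect_hasSum : HasSum effect 1
  prep : Task A B C → Y → Matrix B B ℂ
  prep_isState : ∀ T y, IsState (prep T y)
  rounds : Task A B C → ℕ
  estimate : (T : Task A B C) → (Fin (rounds T) → Y × (A × B × C)) → ℝ

namespace Procedure

variable {A B C Y : Type*} [Fintype A] [Fintype B] [Fintype C]
  [DecidableEq A] [DecidableEq B] [DecidableEq C]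

/-- The subnormalized state of `(A, B, C)` at the end of a round in which the measurement of
`B` gave `y`: the register `A` is left in `Tr_B ((1 ⊗ M_y) ρ)` (whose trace is the probability
of `y`), the register `B` is prepared in `τ_y`, and the unitary of the task acts on `(B, C)`. -/
def finalState (P : Procedure A B C Y) (T : Task A B C)
    (ρ : Matrix (A × B) (A × B) ℂ) (σ : Matrix C C ℂ) (y : Y) :
    Matrix (A × B × C) (A × B × C) ℂ :=
  traceRight (((1 : Matrix A A ℂ) ⊗ₖ P.effect y) * ρ) ⊗ₖ
    ((T.unitary : Matrix (B × C) (B × C) ℂ) * (P.prep T y ⊗ₖ σ) *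
      (T.unitary : Matrix (B × C) (B × C) ℂ).conjTranspose)

/-- The probability that a round gives `y` on the cut register and `z` in the final measurement
of all registers in the standard basis. -/
def roundProb (P : Procedure A B C Y) (T : Task A B C)
    (ρ : Matrix (A × B) (A × B) ℂ) (σ : Matrix C C ℂ) (w : Y × (A × B × C)) : ℝ :=
  (P.finalState T ρ σ w.1 w.2 w.2).re

/-- The probability that the estimate made from the independent rounds is `ε`-accurate. -/
def successProb (P : Procedure A B C Y) (T : Task A B C)
    (ρ : Matrix (A × B) (A × B) ℂ) (σ : Matrix C C ℂ) (ε : ℝ) : ENNReal :=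
  ∑' ω : Fin (P.rounds T) → Y × (A × B × C),
    Set.indicator {ω | |P.estimate T ω - T.value ρ σ| ≤ ε}
      (fun ω => ∏ i, ENNReal.ofReal (P.roundProb T ρ σ (ω i))) ω

/-- The procedure estimates every expectation value up to `ε` with probability at least `p`,
for every task and every unknown input state `ρ ⊗ σ`. -/
def Succeeds (P : Procedure A B C Y) (ε p : ℝ) : Prop :=
  ∀ (T : Task A B C) (ρ : Matrix (A × B) (A × B) ℂ) (σ : Matrix C C ℂ),
    IsState ρ → IsState σ → ENNReal.ofReal p ≤ P.successProb T ρ σ ε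

end Procedure

end WireCutting

end

noncomputable section

namespace WireCutting

/-! ### Testing two hypotheses with independent samples -/

/-! The POVM is fixed before the task, so the task can be aimed at an observable to which the POVM
is nearly blind. Write `d = 2^k`, let `O` be a non-identity Pauli matrix on `B`, and consider the
inputs `α ⊗ (1 ± e O)/d` with the task of measuring `O`. The values are `±e`, so for `e > ε` a
successful procedure tells the two inputs apart.

For a product input all information about the sign sits in `y` (`roundProb_kronecker`): a round has
law `(q ± r) κ` with `q = tr M_y / d`, `r = e tr(M_y O) / d` and a kernel `κ` common to both signs.
The Bhattacharyya coefficient of one round is at least `1 - ∑ r²/q`; it is multiplicative over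
rounds, and success on disjoint events keeps it below `1 - (2p-1)²/2`. With Bernoulli's inequality,
`(2p-1)²/2 ≤ N ∑ r²/q` (`le_mul_of_test`).

Here `∑ r²/q = (e²/d) ∑_y tr(M_y O)² / tr M_y`. By Parseval the squares `|tr(M O)|²` over all Paulis
sum to at most `d (tr M)²`, so the `y`-sums total at most `d ∑_y tr M_y = d²` over `d² - 1`
non-identity Paulis. One of them has `y`-sum at most `2` (`exists_pauli_tsum_le`), and `e ≤ 2ε`
gives `N ≥ c d / ε²`. -/

/-- The sum of a product function over tuples is a power. -/
theorem hasSum_pi_prod {W : Type*} {f : W → ℝ} {a : ℝ} (hf : ∀ w, 0 ≤ f w) (h : HasSum f a)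
    (n : ℕ) : HasSum (fun ω : Fin n → W => ∏ i, f (ω i)) (a ^ n) := by
  induction n with
  | zero => simp
  | succ n ih =>
    have hs : Summable fun x : W × (Fin n → W) => f x.1 * ∏ i, f (x.2 i) :=
      Summable.mul_of_nonneg (g := fun ω : Fin n → W => ∏ i, f (ω i)) h.summable ih.summable hf
        fun ω => Finset.prod_nonneg fun i _ => hf _
    have hm := h.mul ih hs
    rw [← (Fin.consEquiv fun _ => W).hasSum_iff, pow_succ']
    refine hm.congr_fun fun x => ?_
    simp [Fin.prod_univ_succ, Fin.consEquiv]

/-- If two distributions put mass at least `p ≥ 1/2` on disjoint events, then their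
Bhattacharyya coefficient is bounded away from one. -/
theorem tsum_sqrt_mul_le {Ω : Type*} {P Q : Ω → ℝ} (hP : ∀ ω, 0 ≤ P ω) (hQ : ∀ ω, 0 ≤ Q ω)
    (hP1 : HasSum P 1) (hQ1 : HasSum Q 1) {S T : Set Ω} (hST : Disjoint S T) {p : ℝ}
    (hp : 1 / 2 ≤ p) (hS : p ≤ ∑' ω, S.indicator P ω) (hT : p ≤ ∑' ω, T.indicator Q ω) :
    ∑' ω, √(P ω * Q ω) ≤ 1 - (2 * p - 1) ^ 2 / 2 := by
  classical
  have hu := (hP1.summable.indicator S).hasSum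
  have hv := (hQ1.summable.indicator S).hasSum
  have ht := (hQ1.summable.indicator T).hasSum
  set u := ∑' ω, S.indicator P ω
  set v := ∑' ω, S.indicator Q ω
  set t := ∑' ω, T.indicator Q ω
  have hvt : v + t ≤ 1 := by
    refine hasSum_le (fun ω => ?_) (hv.add ht) hQ1
    by_cases h1 : ω ∈ S
    · have h2 : ω ∉ T := Set.disjoint_left.mp hST h1
      simp [h1, h2]
    · by_cases h2 : ω ∈ T <;> simp [h1, h2, hQ ω]
  -- Weighted AM-GM: on `S`, where `P` dominates, `Q` gets weight `s` and `P` weight `1/s`; off `S`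
  -- the roles swap. The choice `s = 2p` is optimal for the extreme case `u - v = 2p - 1`.
  set s : ℝ := 2 * p with hs
  have hs1 : 1 ≤ s := by linarith
  have hs0 : 0 < s := by linarith
  have key : ∀ x y : ℝ, 0 ≤ x → 0 ≤ y → √(x * y) ≤ (s * x + y / s) / 2 := by
    intro x y hx hy
    rw [Real.sqrt_le_left (by positivity)]
    have : x * y = (s * x) * (y / s) := by field_simp
    nlinarith [sq_nonneg (s * x - y / s)]
  have hbound : HasSum (fun ω => (s * (P ω - S.indicator P ω + S.indicator Q ω)
      + (Q ω - S.indicator Q ω + S.indicator P ω) / s) / 2)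
      ((s * (1 - u + v) + (1 - v + u) / s) / 2) :=
    ((((hP1.sub hu).add hv).mul_left s).add (((hQ1.sub hv).add hu).div_const s)).div_const 2
  have hle : ∀ ω, √(P ω * Q ω) ≤ (s * (P ω - S.indicator P ω + S.indicator Q ω)
      + (Q ω - S.indicator Q ω + S.indicator P ω) / s) / 2 := by
    intro ω
    by_cases h1 : ω ∈ S
    · simpa [h1, mul_comm (P ω)] using key (Q ω) (P ω) (hQ ω) (hP ω)
    · simpa [h1] using key (P ω) (Q ω) (hP ω) (hQ ω)
  have hsum : Summable fun ω => √(P ω * Q ω) :=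
    hbound.summable.of_nonneg_of_le (fun ω => Real.sqrt_nonneg _) hle
  refine (hasSum_le hle hsum.hasSum hbound).trans ?_
  have hη : s - 1 ≤ u - v := by linarith
  have h3 : (1 - v + u) / s = 1 + (u - v - (s - 1)) / s := by field_simp; ring
  have h4 : (u - v - (s - 1)) / s ≤ u - v - (s - 1) := div_le_self (by linarith) hs1
  rw [h3]
  nlinarith [mul_nonneg (sub_nonneg.mpr hs1) (sub_nonneg.mpr hη)]

theorem hasSum_mul_kernel {Y Z : Type*} [Fintype Z] {g : Y → ℝ} {κ : Y × Z → ℝ} {a : ℝ}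
    (hg : ∀ y, 0 ≤ g y) (hga : HasSum g a) (hκ : ∀ w, 0 ≤ κ w) (hκ1 : ∀ y, ∑ z, κ (y, z) = 1) :
    HasSum (fun w : Y × Z => g w.1 * κ w) a := by
  have hz : ∀ y, HasSum (fun z => g y * κ (y, z)) (g y) := fun y => by
    simpa [← Finset.mul_sum, hκ1] using hasSum_fintype (fun z => g y * κ (y, z))
  have hs : Summable (fun w : Y × Z => g w.1 * κ w) := by
    rw [summable_prod_of_nonneg fun w => mul_nonneg (hg _) (hκ _)]
    exact ⟨fun y => (hz y).summable, by simpa only [(hz _).tsum_eq] using hga.summable⟩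
  have := hs.hasSum.prod_fiberwise hz
  rw [hga.unique this]
  exact hs.hasSum

/-- The distributions `(q ± r) κ`, where `κ` is a stochastic kernel, have a Bhattacharyya
coefficient at least `1 - ∑ r² / q`. -/
theorem le_tsum_sqrt_mul_kernel {Y Z : Type*} [Fintype Z] {q r : Y → ℝ} {κ : Y × Z → ℝ}
    (hq : HasSum q 1) (hr : ∀ y, |r y| ≤ q y)
    (hκ : ∀ w, 0 ≤ κ w) (hκ1 : ∀ y, ∑ z, κ (y, z) = 1)
    (hs : Summable fun w : Y × Z => √(((q w.1 + r w.1) * κ w) * ((q w.1 - r w.1) * κ w))) :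
    1 - ∑' y, r y ^ 2 / q y ≤
      ∑' w : Y × Z, √(((q w.1 + r w.1) * κ w) * ((q w.1 - r w.1) * κ w)) := by
  have hq0 : ∀ y, 0 ≤ q y := fun y => (abs_nonneg _).trans (hr y)
  have hrq : ∀ y, r y ^ 2 / q y ≤ q y := fun y => by
    refine div_le_of_le_mul₀ (hq0 y) (hq0 y) ?_
    have := sq_le_sq' (abs_le.mp (hr y)).1 (abs_le.mp (hr y)).2
    nlinarith
  have hsr : Summable fun y => r y ^ 2 / q y :=
    hq.summable.of_nonneg_of_le (fun y => div_nonneg (sq_nonneg _) (hq0 y)) hrq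
  have h1 := hasSum_mul_kernel (fun y => sub_nonneg.mpr (hrq y)) (hq.sub hsr.hasSum) hκ hκ1
  refine hasSum_le (fun w => ?_) h1 hs.hasSum
  have h2 : (q w.1 + r w.1) * κ w * ((q w.1 - r w.1) * κ w) =
      (q w.1 ^ 2 - r w.1 ^ 2) * κ w ^ 2 := by ring
  rw [h2]
  -- It remains to check `(q - r²/q)² ≤ q² - r²`, which follows from `r² ≤ q²`. If `q = 0` then `r =
  -- 0`, and the convention `0 / 0 = 0` is harmless.
  refine Real.le_sqrt_of_sq_le ?_
  rw [mul_pow]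
  refine mul_le_mul_of_nonneg_right ?_ (sq_nonneg _)
  rcases (hq0 w.1).eq_or_lt with h0 | h0
  · have : r w.1 = 0 := by have := hr w.1; rw [← h0] at this; exact abs_nonpos_iff.mp this
    simp [← h0, this]
  · have h3 : r w.1 ^ 2 = q w.1 * (r w.1 ^ 2 / q w.1) := by field_simp
    have h4 : 0 ≤ r w.1 ^ 2 / q w.1 := by positivity
    have h5 := hrq w.1
    nlinarith [mul_nonneg h4 (sub_nonneg.mpr h5)]

/-- The number of samples needed to tell `(q + r) κ` from `(q - r) κ`. -/
theorem le_mul_of_test {Y Z : Type*} [Fintype Z] {q r : Y → ℝ} {κ : Y × Z → ℝ}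
    (hq : HasSum q 1) (hr : ∀ y, |r y| ≤ q y) (hr0 : HasSum r 0)
    (hκ : ∀ w, 0 ≤ κ w) (hκ1 : ∀ y, ∑ z, κ (y, z) = 1) (n : ℕ)
    {S T : Set (Fin n → Y × Z)} (hST : Disjoint S T) {p : ℝ} (hp : 1 / 2 ≤ p)
    (hS : p ≤ ∑' ω, S.indicator (fun ω => ∏ i, (q (ω i).1 + r (ω i).1) * κ (ω i)) ω)
    (hT : p ≤ ∑' ω, T.indicator (fun ω => ∏ i, (q (ω i).1 - r (ω i).1) * κ (ω i)) ω) :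
    (2 * p - 1) ^ 2 / 2 ≤ n * ∑' y, r y ^ 2 / q y := by
  have hadd : ∀ y, 0 ≤ q y + r y := fun y => by linarith [(abs_le.mp (hr y)).1]
  have hsub : ∀ y, 0 ≤ q y - r y := fun y => by linarith [(abs_le.mp (hr y)).2]
  have hP0 : ∀ w : Y × Z, 0 ≤ (q w.1 + r w.1) * κ w := fun w => mul_nonneg (hadd _) (hκ _)
  have hQ0 : ∀ w : Y × Z, 0 ≤ (q w.1 - r w.1) * κ w := fun w => mul_nonneg (hsub _) (hκ _)
  have hP := hasSum_mul_kernel hadd (by simpa using hq.add hr0) hκ hκ1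
  have hQ := hasSum_mul_kernel hsub (by simpa using hq.sub hr0) hκ hκ1
  have hs : Summable fun w : Y × Z =>
      √(((q w.1 + r w.1) * κ w) * ((q w.1 - r w.1) * κ w)) := by
    refine (hP.add hQ).summable.of_nonneg_of_le (fun w => Real.sqrt_nonneg _) fun w => ?_
    rw [Real.sqrt_le_left (add_nonneg (hP0 w) (hQ0 w))]
    nlinarith [mul_nonneg (hP0 w) (hQ0 w), sq_nonneg ((q w.1 + r w.1) * κ w),
      sq_nonneg ((q w.1 - r w.1) * κ w)]
  have hone := le_tsum_sqrt_mul_kernel hq hr hκ hκ1 hs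
  have hpow := hasSum_pi_prod (fun w => Real.sqrt_nonneg _) hs.hasSum n
  have htest := tsum_sqrt_mul_le (fun ω => Finset.prod_nonneg fun i _ => hP0 (ω i))
    (fun ω => Finset.prod_nonneg fun i _ => hQ0 (ω i))
    (by simpa using hasSum_pi_prod hP0 hP n) (by simpa using hasSum_pi_prod hQ0 hQ n)
    hST hp hS hT
  have heq : ∀ ω : Fin n → Y × Z,
      √((∏ i, (q (ω i).1 + r (ω i).1) * κ (ω i)) * ∏ i, (q (ω i).1 - r (ω i).1) * κ (ω i)) =
      ∏ i, √(((q (ω i).1 + r (ω i).1) * κ (ω i)) * ((q (ω i).1 - r (ω i).1) * κ (ω i))) := by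
    intro ω
    rw [← Finset.prod_mul_distrib, Real.sqrt_prod _ fun i _ => mul_nonneg (hP0 _) (hQ0 _)]
  rw [tsum_congr heq, hpow.tsum_eq] at htest
  set b := ∑' w : Y × Z, √(((q w.1 + r w.1) * κ w) * ((q w.1 - r w.1) * κ w))
  have hb : 0 ≤ b := tsum_nonneg fun w => Real.sqrt_nonneg _
  -- Bernoulli: `b ^ n ≥ 1 - n (1 - b)`.
  have hbern := one_add_mul_le_pow (a := b - 1) (by linarith) n
  rw [add_sub_cancel] at hbern
  have : (n : ℝ) * (1 - ∑' y, r y ^ 2 / q y) ≤ n * b :=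
    mul_le_mul_of_nonneg_left hone n.cast_nonneg
  nlinarith

/-! ### Positive semidefinite matrices -/

section Matrices

variable {n : Type*}

/-- The principal 2×2 minor on `i, j` is nonnegative; for `i = j` the submatrix repeats a row. -/
theorem norm_apply_sq_le {M : Matrix n n ℂ} (hM : M.PosSemidef) (i j : n) :
    ‖M i j‖ ^ 2 ≤ (M i i).re * (M j j).re := by
  have h := (hM.submatrix ![i, j]).det_nonneg
  have hji : M j i = star (M i j) := (hM.isHermitian.apply j i).symm
  have hi := Complex.nonneg_iff.mp (hM.diag_nonneg (i := i))
  have hj := Complex.nonneg_iff.mp (hM.diag_nonneg (i := j))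
  rw [Matrix.det_fin_two] at h
  have h' := (Complex.nonneg_iff.mp h).1
  simp only [Matrix.submatrix_apply, Matrix.cons_val_zero, Matrix.cons_val_one, hji,
    Complex.sub_re, Complex.mul_re, ← hi.2, ← hj.2] at h'
  rw [Complex.sq_norm, Complex.normSq_apply]
  simp at h'
  linarith

variable [Fintype n]

theorem sum_norm_sq_le {M : Matrix n n ℂ} (hM : M.PosSemidef) :
    ∑ i, ∑ j, ‖M i j‖ ^ 2 ≤ M.trace.re ^ 2 := by
  have : M.trace.re = ∑ i, (M i i).re := by simp [Matrix.trace]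
  rw [this, sq, Finset.sum_mul_sum]
  exact Finset.sum_le_sum fun i _ => Finset.sum_le_sum fun j _ => norm_apply_sq_le hM i j

theorem trace_mul_im_eq_zero {M N : Matrix n n ℂ} (hM : M.IsHermitian) (hN : N.IsHermitian) :
    (M * N).trace.im = 0 := by
  rw [← Complex.conj_eq_iff_im, starRingEnd_apply,
    ← Matrix.trace_conjTranspose, Matrix.conjTranspose_mul, hM.eq, hN.eq, Matrix.trace_mul_comm]

-- With `N = B* B`, cyclicity gives `tr(M N) = tr(B M B*)`.
open scoped MatrixOrder in
theorem trace_mul_nonneg {M N : Matrix n n ℂ} (hM : M.PosSemidef) (hN : N.PosSemidef) :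
    0 ≤ (M * N).trace := by
  classical
  obtain ⟨B, rfl⟩ := CStarAlgebra.nonneg_iff_eq_star_mul_self.mp hN.nonneg
  rw [Matrix.star_eq_conjTranspose, ← Matrix.mul_assoc, Matrix.trace_mul_comm, ← Matrix.mul_assoc]
  exact (hM.mul_mul_conjTranspose_same B).trace_nonneg

variable [DecidableEq n] {O : Matrix n n ℂ}

/-- Since `(1 ± O)² = 2 (1 ± O)`, both `1 ± O` are positive, and `1 + e O` is their combination with
weights `(1 ± e)/2`. -/
theorem posSemidef_one_add_smul (hO : O.IsHermitian) (hO2 : O * O = 1) {e : ℝ} (he : |e| ≤ 1) :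
    (1 + (e : ℂ) • O).PosSemidef := by
  have hadd : (1 + O).PosSemidef := by
    have h := Matrix.posSemidef_self_mul_conjTranspose (1 + O)
    have h2 : (1 + O) * (1 + O).conjTranspose = (2 : ℂ) • (1 + O) := by
      rw [Matrix.conjTranspose_add, Matrix.conjTranspose_one, hO.eq, mul_add, add_mul, add_mul, hO2,
        two_smul]
      simp only [one_mul, mul_one]; abel
    rw [h2] at h
    have := h.smul (show (0 : ℂ) ≤ 1 / 2 by norm_num [Complex.le_def])
    simpa [smul_smul] using this
  have hsub : (1 - O).PosSemidef := by
    have h := Matrix.posSemidef_self_mul_conjTranspose (1 - O)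
    have h2 : (1 - O) * (1 - O).conjTranspose = (2 : ℂ) • (1 - O) := by
      rw [Matrix.conjTranspose_sub, Matrix.conjTranspose_one, hO.eq, mul_sub, sub_mul, sub_mul, hO2,
        two_smul]
      simp only [one_mul, mul_one]; abel
    rw [h2] at h
    have := h.smul (show (0 : ℂ) ≤ 1 / 2 by norm_num [Complex.le_def])
    simpa [smul_smul] using this
  have h1 : (0 : ℂ) ≤ (((1 + e) / 2 : ℝ) : ℂ) :=
    Complex.zero_le_real.mpr (by linarith [(abs_le.mp he).1])
  have h2 : (0 : ℂ) ≤ (((1 - e) / 2 : ℝ) : ℂ) :=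
    Complex.zero_le_real.mpr (by linarith [(abs_le.mp he).2])
  have h3 := (hadd.smul h1).add (hsub.smul h2)
  convert h3 using 1
  push_cast
  module

/-- A Hermitian involution is diagonal, with entries in `[-1, 1]`, in some orthonormal basis. -/
theorem exists_unitary_diagonal (hO : O.IsHermitian) (hO2 : O * O = 1) :
    ∃ (V : Matrix.unitaryGroup n ℂ) (l : n → ℝ), (∀ i, |l i| ≤ 1) ∧
      O = (V : Matrix n n ℂ).conjTranspose * Matrix.diagonal (fun i => (l i : ℂ)) *
        (V : Matrix n n ℂ) := by
  have hs := hO.spectral_theorem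
  rw [Unitary.conjStarAlgAut_apply] at hs
  set W := hO.eigenvectorUnitary
  set l := hO.eigenvalues
  have hW : star (W : Matrix n n ℂ) * (W : Matrix n n ℂ) = 1 := Unitary.coe_star_mul_self W
  have hW' : (W : Matrix n n ℂ) * star (W : Matrix n n ℂ) = 1 := Unitary.coe_mul_star_self W
  have hD : Matrix.diagonal (RCLike.ofReal ∘ l) = star (W : Matrix n n ℂ) * O * (W : Matrix n n ℂ) := by
    rw [hs]
    calc _ = (star (W : Matrix n n ℂ) * (W : Matrix n n ℂ)) * Matrix.diagonal (RCLike.ofReal ∘ l) *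
          (star (W : Matrix n n ℂ) * (W : Matrix n n ℂ)) := by rw [hW, one_mul, mul_one]
      _ = _ := by simp only [mul_assoc]
  refine ⟨star W, l, fun i => ?_, ?_⟩
  · have h2 : Matrix.diagonal (RCLike.ofReal ∘ l) * Matrix.diagonal (RCLike.ofReal ∘ l) =
        (1 : Matrix n n ℂ) := by
      rw [hD]
      calc _ = star (W : Matrix n n ℂ) * O * ((W : Matrix n n ℂ) * star (W : Matrix n n ℂ)) * O *
            (W : Matrix n n ℂ) := by
            simp only [mul_assoc]
        _ = star (W : Matrix n n ℂ) * (O * O) * (W : Matrix n n ℂ) := by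
            rw [hW', mul_one]; simp only [mul_assoc]
        _ = 1 := by rw [hO2, mul_one, hW]
    have h3 := congrFun (congrFun h2 i) i
    rw [Matrix.diagonal_mul_diagonal, Matrix.diagonal_apply_eq, Matrix.one_apply_eq] at h3
    have h4 : l i * l i = 1 := by
      have : ((l i : ℂ)) * (l i : ℂ) = 1 := h3
      exact_mod_cast this
    rw [abs_le_one_iff_mul_self_le_one, h4]
  · rw [Unitary.coe_star, Matrix.star_eq_conjTranspose, Matrix.conjTranspose_conjTranspose]
    exact hs

end Matrices

/-! ### Pauli matrices on an elementary abelian 2-group -/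

section Pauli

variable {G : Type*} [AddCommGroup G]

theorem addChar_mul_self (h2 : ∀ x : G, x + x = 0) (ψ : AddChar G ℂ) (x : G) :
    ψ x * ψ x = 1 := by
  rw [← AddChar.map_add_eq_mul, h2, AddChar.map_zero_eq_one]

theorem star_addChar (h2 : ∀ x : G, x + x = 0) (ψ : AddChar G ℂ) (x : G) :
    star (ψ x) = ψ x := by
  rcases mul_self_eq_one_iff.mp (addChar_mul_self h2 ψ x) with h | h <;> simp [h]

variable [DecidableEq G]

/-- The Hermitian multiple of the composition of the character `ψ` with the shift by `a`. -/
def pauli (a : G) (ψ : AddChar G ℂ) : Matrix G G ℂ :=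
  Matrix.of fun x y => if x = y + a then (if ψ a = 1 then 1 else Complex.I) * ψ y else 0

/-- Taking the adjoint costs the sign `ψ a = ±1`; when it is `-1`, conjugating the prefactor `I`
cancels it. -/
theorem isHermitian_pauli (h2 : ∀ x : G, x + x = 0) (a : G) (ψ : AddChar G ℂ) :
    (pauli a ψ).IsHermitian := by
  ext x y
  simp only [pauli, Matrix.conjTranspose_apply, Matrix.of_apply]
  by_cases h : x = y + a
  · subst h
    have : y = y + a + a := by rw [add_assoc, h2, add_zero]
    rw [if_pos rfl, if_pos this, star_mul', star_addChar h2, AddChar.map_add_eq_mul]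
    rcases mul_self_eq_one_iff.mp (addChar_mul_self h2 ψ a) with h | h
    · simp [h]
    · rw [h]
      norm_num
  · have : ¬ y = x + a := fun h' => h (by rw [h', add_assoc, h2, add_zero])
    simp [h, this]

variable [Fintype G]

theorem pauli_mul_self (h2 : ∀ x : G, x + x = 0) (a : G) (ψ : AddChar G ℂ) :
    pauli a ψ * pauli a ψ = 1 := by
  ext x z
  rw [Matrix.mul_apply, Finset.sum_eq_single (z + a)]
  · have : z + a + a = z := by rw [add_assoc, h2, add_zero]
    simp only [pauli, Matrix.of_apply, this, if_true, Matrix.one_apply, AddChar.map_add_eq_mul]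
    have hz := addChar_mul_self h2 ψ z
    split_ifs with h h' h'
    · rw [h']; linear_combination hz
    · rcases mul_self_eq_one_iff.mp (addChar_mul_self h2 ψ a) with h3 | h3
      · exact absurd h3 h'
      · rw [h3]; linear_combination (-ψ z * ψ z) * Complex.I_mul_I + hz
    · simp
    · simp
  · intro y _ hy
    simp [pauli, hy]
  · simp

theorem trace_pauli {a : G} {ψ : AddChar G ℂ} (h : (a, ψ) ≠ 0) : (pauli a ψ).trace = 0 := by
  by_cases ha : a = 0
  · subst ha
    have hψ : ψ ≠ 0 := fun h' => h (by rw [h']; rfl)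
    have := AddChar.sum_eq_zero_iff_ne_zero.mpr hψ
    simp [pauli, Matrix.trace, this]
  · simp [pauli, Matrix.trace, ha]

/-- Up to a phase, the traces for fixed `a` are the Fourier coefficients of the shifted diagonal `y
↦ M y (y + a)`. -/
theorem trace_mul_pauli (M : Matrix G G ℂ) (a : G) (ψ : AddChar G ℂ) :
    (M * pauli a ψ).trace = (if ψ a = 1 then 1 else Complex.I) * ∑ y, M y (y + a) * ψ y := by
  simp only [Matrix.trace, Matrix.diag, Matrix.mul_apply, pauli, Matrix.of_apply, mul_ite,
    mul_zero, Finset.sum_ite_eq', Finset.mem_univ, if_true, Finset.mul_sum]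
  refine Finset.sum_congr rfl fun y _ => ?_
  split_ifs <;> ring

/-- The Parseval identity for the characters of an elementary abelian 2-group. -/
theorem sum_norm_sq_sum_mul_addChar (h2 : ∀ x : G, x + x = 0) (g : G → ℂ) :
    ∑ ψ : AddChar G ℂ, ‖∑ y, g y * ψ y‖ ^ 2 = Fintype.card G * ∑ y, ‖g y‖ ^ 2 := by
  apply Complex.ofReal_injective
  push_cast
  have hterm : ∀ ψ : AddChar G ℂ, ((‖∑ y, g y * ψ y‖ : ℂ)) ^ 2 =
      ∑ x, ∑ y, g x * star (g y) * ψ (x + y) := by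
    intro ψ
    rw [← Complex.mul_conj', map_sum, Finset.sum_mul_sum]
    refine Finset.sum_congr rfl fun x _ => Finset.sum_congr rfl fun y _ => ?_
    have := star_addChar h2 ψ y
    rw [map_mul, starRingEnd_apply, starRingEnd_apply, this, AddChar.map_add_eq_mul]
    ring
  simp only [hterm]
  rw [Finset.sum_comm, Finset.mul_sum]
  refine Finset.sum_congr rfl fun x _ => ?_
  rw [Finset.sum_comm, Finset.sum_eq_single x]
  · rw [← Finset.mul_sum, AddChar.sum_apply_eq_ite, if_pos (h2 x), ← Complex.mul_conj',
      starRingEnd_apply]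
    ring
  · intro y _ hy
    have : x + y ≠ 0 := fun h => hy (by
      rw [← add_zero y, ← h2 x, add_left_comm, add_comm y x, h, add_zero])
    rw [← Finset.mul_sum, AddChar.sum_apply_eq_ite, if_neg this, mul_zero]
  · simp

/-- Parseval applies on each shifted diagonal; these diagonals partition the entries, and the
squared Hilbert–Schmidt norm of a positive matrix is at most its squared trace. -/
theorem sum_norm_trace_mul_pauli_sq_le (h2 : ∀ x : G, x + x = 0) {M : Matrix G G ℂ}
    (hM : M.PosSemidef) :
    ∑ j : G × AddChar G ℂ, ‖(M * pauli j.1 j.2).trace‖ ^ 2 ≤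
      Fintype.card G * M.trace.re ^ 2 := by
  have hterm : ∀ (a : G) (ψ : AddChar G ℂ), ‖(M * pauli a ψ).trace‖ ^ 2 =
      ‖∑ y, M y (y + a) * ψ y‖ ^ 2 := by
    intro a ψ
    rw [trace_mul_pauli, norm_mul]
    split_ifs <;> simp
  simp only [Fintype.sum_prod_type, hterm, sum_norm_sq_sum_mul_addChar h2]
  rw [← Finset.mul_sum, Finset.sum_comm]
  refine mul_le_mul_of_nonneg_left ?_ (Nat.cast_nonneg _)
  refine le_trans (le_of_eq ?_) (sum_norm_sq_le hM)
  exact Finset.sum_congr rfl fun y _ => Equiv.sum_comp (Equiv.addLeft y) fun x => ‖M y x‖ ^ 2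

end Pauli

/-! ### The tasks and states that are hard for a procedure -/

section Hard

variable {A B C Y : Type*} [Fintype B] [Fintype C]

theorem traceRight_one_kronecker_mul [Fintype A] [DecidableEq A] (α : Matrix A A ℂ)
    (M β : Matrix B B ℂ) :
    traceRight (((1 : Matrix A A ℂ) ⊗ₖ M) * (α ⊗ₖ β)) = (M * β).trace • α := by
  rw [← Matrix.mul_kronecker_mul, one_mul]
  ext a a'
  simp [traceRight, Matrix.trace, ← Finset.mul_sum, mul_comm]

theorem IsState.kronecker [Fintype A] {α : Matrix A A ℂ} {β : Matrix B B ℂ} (hα : IsState α)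
    (hβ : IsState β) : IsState (α ⊗ₖ β) :=
  ⟨hα.1.kronecker hβ.1, by rw [Matrix.trace_kronecker, hα.2, hβ.2, one_mul]⟩

variable [DecidableEq B] [DecidableEq C]

/-- The state `(1 + e O) / d` of a register of dimension `d`. -/
def tilted (O : Matrix B B ℂ) (e : ℝ) : Matrix B B ℂ :=
  (Fintype.card B : ℂ)⁻¹ • (1 + (e : ℂ) • O)

theorem isState_tilted [Nonempty B] {O : Matrix B B ℂ} (hO : O.IsHermitian) (hO2 : O * O = 1)
    (htr : O.trace = 0) {e : ℝ} (he : |e| ≤ 1) : IsState (tilted O e) := by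
  refine ⟨(posSemidef_one_add_smul hO hO2 he).smul ?_, ?_⟩
  · rw [← Complex.ofReal_natCast, ← Complex.ofReal_inv]
    exact Complex.zero_le_real.mpr (by positivity)
  · rw [tilted, Matrix.trace_smul, Matrix.trace_add, Matrix.trace_smul, htr, Matrix.trace_one]
    simp

theorem trace_mul_tilted_self [Nonempty B] {O : Matrix B B ℂ} (hO2 : O * O = 1)
    (htr : O.trace = 0) (e : ℝ) : (O * tilted O e).trace = e := by
  rw [tilted, Matrix.mul_smul, mul_add, Matrix.mul_smul, hO2, mul_one, Matrix.trace_smul,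
    Matrix.trace_add, Matrix.trace_smul, htr, Matrix.trace_one]
  have : (Fintype.card B : ℂ) ≠ 0 := Nat.cast_ne_zero.mpr Fintype.card_ne_zero
  simp only [smul_eq_mul, zero_add]
  field_simp

theorem IsState.conj {ρ : Matrix B B ℂ} (hρ : IsState ρ) (U : Matrix.unitaryGroup B ℂ) :
    IsState ((U : Matrix B B ℂ) * ρ * (U : Matrix B B ℂ).conjTranspose) := by
  refine ⟨hρ.1.mul_mul_conjTranspose_same _, ?_⟩
  rw [Matrix.trace_mul_comm, ← mul_assoc, ← Matrix.star_eq_conjTranspose,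
    Unitary.coe_star_mul_self, one_mul, hρ.2]

namespace Procedure

variable (P : Procedure A B C Y)

theorem hasSum_trace_effect_mul (O : Matrix B B ℂ) :
    HasSum (fun y => (P.effect y * O).trace.re) O.trace.re := by
  have h := P.effect_hasSum.map
    ((Complex.reAddGroupHom.comp (Matrix.traceAddMonoidHom B ℂ)).comp (AddMonoidHom.mulRight O))
    (Complex.continuous_re.comp ((continuous_id.matrix_mul continuous_const).matrix_trace))
  simpa [Function.comp_def] using h

theorem trace_effect_mul_tilted (O : Matrix B B ℂ) (e : ℝ) (y : Y) :
    (P.effect y * tilted O e).trace.re =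
      (P.effect y).trace.re / Fintype.card B +
        e * ((P.effect y * O).trace.re / Fintype.card B) := by
  rw [tilted, Matrix.mul_smul, mul_add, Matrix.mul_smul, mul_one, Matrix.trace_smul,
    Matrix.trace_add, Matrix.trace_smul, smul_eq_mul, smul_eq_mul, ← Complex.ofReal_natCast,
    ← Complex.ofReal_inv, Complex.re_ofReal_mul, Complex.add_re, Complex.re_ofReal_mul]
  ring

/-- Positivity of `tr(M_y (1 ± O))`; this becomes `|r| ≤ q` in the two-hypothesis test. -/
theorem abs_trace_effect_mul_le {O : Matrix B B ℂ} (hO : O.IsHermitian) (hO2 : O * O = 1)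
    (y : Y) : |(P.effect y * O).trace.re| ≤ (P.effect y).trace.re := by
  have key : ∀ e : ℝ, |e| ≤ 1 → 0 ≤ (P.effect y).trace.re + e * (P.effect y * O).trace.re := by
    intro e he
    have h := (Complex.nonneg_iff.mp
      (trace_mul_nonneg (P.effect_posSemidef y) (posSemidef_one_add_smul hO hO2 he))).1
    rwa [mul_add, mul_one, Matrix.mul_smul, Matrix.trace_add, Matrix.trace_smul, smul_eq_mul,
      Complex.add_re, Complex.re_ofReal_mul] at h
  have h1 := key 1 (by simp)
  have h2 := key (-1) (by simp)
  rw [abs_le]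
  constructor <;> linarith

variable [Fintype A]

/-- The law of the final measurement outcomes, given the outcome on the cut register, for an
input in a product state. -/
def outcomeKernel (T : Task A B C) (α : Matrix A A ℂ) (σ : Matrix C C ℂ)
    (w : Y × (A × B × C)) : ℝ :=
  ((α ⊗ₖ ((T.unitary : Matrix (B × C) (B × C) ℂ) * (P.prep T w.1 ⊗ₖ σ) *
      (T.unitary : Matrix (B × C) (B × C) ℂ).conjTranspose)) w.2 w.2).re

theorem isState_outcome (T : Task A B C) {α : Matrix A A ℂ} (hα : IsState α) {σ : Matrix C C ℂ}
    (hσ : IsState σ) (y : Y) :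
    IsState (α ⊗ₖ ((T.unitary : Matrix (B × C) (B × C) ℂ) * (P.prep T y ⊗ₖ σ) *
      (T.unitary : Matrix (B × C) (B × C) ℂ).conjTranspose)) :=
  hα.kronecker (((P.prep_isState T y).kronecker hσ).conj T.unitary)

theorem outcomeKernel_nonneg (T : Task A B C) {α : Matrix A A ℂ} (hα : IsState α)
    {σ : Matrix C C ℂ} (hσ : IsState σ) (w : Y × (A × B × C)) : 0 ≤ P.outcomeKernel T α σ w :=
  (Complex.nonneg_iff.mp (P.isState_outcome T hα hσ w.1).1.diag_nonneg).1

theorem sum_outcomeKernel (T : Task A B C) {α : Matrix A A ℂ} (hα : IsState α)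
    {σ : Matrix C C ℂ} (hσ : IsState σ) (y : Y) : ∑ z, P.outcomeKernel T α σ (y, z) = 1 := by
  have h := congrArg Complex.re (P.isState_outcome T hα hσ y).2
  rw [Matrix.trace, Complex.re_sum, Complex.one_re] at h
  exact h

end Procedure

variable [Fintype A] [DecidableEq A]

theorem exists_isState [Nonempty A] : ∃ α : Matrix A A ℂ, IsState α := by
  obtain ⟨a⟩ := ‹Nonempty A›
  refine ⟨Matrix.diagonal (Pi.single a 1), ?_, by simp [Matrix.trace_diagonal]⟩
  refine Matrix.PosSemidef.diagonal fun i => ?_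
  by_cases h : i = a
  · subst h; simp
  · simp [h]

/-- Rotating the register `B` by `V` and reading off a function of its basis states. -/
def rotationTask (V : Matrix.unitaryGroup B ℂ) (l : B → ℝ) (hl : ∀ b, |l b| ≤ 1) :
    Task A B C where
  unitary := ⟨(V : Matrix B B ℂ) ⊗ₖ (1 : Matrix C C ℂ),
    Matrix.kronecker_mem_unitary V.2 (one_mem _)⟩
  f z := l z.2.1
  abs_f_le _ := hl _

theorem value_rotationTask (V : Matrix.unitaryGroup B ℂ) (l : B → ℝ) (hl : ∀ b, |l b| ≤ 1)
    {α : Matrix A A ℂ} (hα : IsState α) (β : Matrix B B ℂ) {σ : Matrix C C ℂ} (hσ : IsState σ) :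
    (rotationTask V l hl : Task A B C).value (α ⊗ₖ β) σ =
      ((V : Matrix B B ℂ).conjTranspose * Matrix.diagonal (fun b => (l b : ℂ)) *
        (V : Matrix B B ℂ) * β).trace.re := by
  have hd : Matrix.diagonal (fun z : A × B × C => (l z.2.1 : ℂ)) =
      (1 : Matrix A A ℂ) ⊗ₖ (Matrix.diagonal (fun b => (l b : ℂ)) ⊗ₖ (1 : Matrix C C ℂ)) := by
    rw [← Matrix.diagonal_one, ← Matrix.diagonal_one, Matrix.diagonal_kronecker_diagonal,
      Matrix.diagonal_kronecker_diagonal]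
    simp
  simp only [Task.value, rotationTask]
  rw [hd, Matrix.kronecker_assoc, Matrix.conjTranspose_kronecker, Matrix.conjTranspose_kronecker,
    ← Matrix.mul_kronecker_mul, ← Matrix.mul_kronecker_mul, ← Matrix.mul_kronecker_mul,
    ← Matrix.mul_kronecker_mul, ← Matrix.mul_kronecker_mul, ← Matrix.mul_kronecker_mul,
    Matrix.trace_kronecker, Matrix.trace_kronecker]
  simp only [Matrix.conjTranspose_one, one_mul, mul_one, hα.2, hσ.2]
  rw [← mul_assoc, Matrix.trace_mul_comm]
  simp only [mul_assoc]

namespace Procedure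

variable (P : Procedure A B C Y)

/-- The post-measurement state of `A` is `α` whatever `y` is, so `β` enters only through the
probability of `y`. -/
theorem roundProb_kronecker (T : Task A B C) (α : Matrix A A ℂ) {β : Matrix B B ℂ}
    (hβ : β.IsHermitian) (σ : Matrix C C ℂ) (w : Y × (A × B × C)) :
    P.roundProb T (α ⊗ₖ β) σ w = (P.effect w.1 * β).trace.re * P.outcomeKernel T α σ w := by
  rw [roundProb, finalState, traceRight_one_kronecker_mul, Matrix.smul_kronecker,
    Matrix.smul_apply, smul_eq_mul, Complex.mul_re,
    trace_mul_im_eq_zero (P.effect_posSemidef _).isHermitian hβ, zero_mul, sub_zero]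
  rfl

/-- Success probabilities as sums of real numbers. -/
theorem le_tsum_of_succeeds {ε p : ℝ} (hP : P.Succeeds ε p) (T : Task A B C)
    {ρ : Matrix (A × B) (A × B) ℂ} {σ : Matrix C C ℂ} (hρ : IsState ρ) (hσ : IsState σ)
    (hn : ∀ w, 0 ≤ P.roundProb T ρ σ w) (hs : Summable (P.roundProb T ρ σ)) :
    p ≤ ∑' ω : Fin (P.rounds T) → Y × (A × B × C),
      Set.indicator {ω | |P.estimate T ω - T.value ρ σ| ≤ ε}
        (fun ω => ∏ i, P.roundProb T ρ σ (ω i)) ω := by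
  have h := hP T ρ σ hρ hσ
  have h0 : ∀ ω : Fin (P.rounds T) → Y × (A × B × C), 0 ≤
      Set.indicator {ω | |P.estimate T ω - T.value ρ σ| ≤ ε}
        (fun ω => ∏ i, P.roundProb T ρ σ (ω i)) ω :=
    fun ω => Set.indicator_nonneg (fun ω _ => Finset.prod_nonneg fun i _ => hn _) ω
  have heq : P.successProb T ρ σ ε = ∑' ω : Fin (P.rounds T) → Y × (A × B × C),
      ENNReal.ofReal (Set.indicator {ω | |P.estimate T ω - T.value ρ σ| ≤ ε}
        (fun ω => ∏ i, P.roundProb T ρ σ (ω i)) ω) := by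
    refine tsum_congr fun ω => ?_
    by_cases hω : ω ∈ {ω | |P.estimate T ω - T.value ρ σ| ≤ ε}
    · rw [Set.indicator_of_mem hω, Set.indicator_of_mem hω,
        ENNReal.ofReal_prod_of_nonneg fun i _ => hn _]
    · rw [Set.indicator_of_notMem hω, Set.indicator_of_notMem hω, ENNReal.ofReal_zero]
  have hsum := (hasSum_pi_prod hn hs.hasSum (P.rounds T)).summable.indicator
    {ω | |P.estimate T ω - T.value ρ σ| ≤ ε}
  rw [heq, ← ENNReal.ofReal_tsum_of_nonneg h0 hsum] at h
  exact (ENNReal.ofReal_le_ofReal_iff (tsum_nonneg h0)).mp h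

end Procedure

end Hard

/-! ### The lower bound -/

theorem sum_trace_mul_pauli_sq_div_le {G : Type*} [AddCommGroup G] [Fintype G] [DecidableEq G]
    (h2 : ∀ x : G, x + x = 0) {M : Matrix G G ℂ} (hM : M.PosSemidef)
    (s : Finset (G × AddChar G ℂ)) :
    ∑ j ∈ s, (M * pauli j.1 j.2).trace.re ^ 2 / M.trace.re ≤ Fintype.card G * M.trace.re := by
  have hM0 : 0 ≤ M.trace.re := (Complex.nonneg_iff.mp hM.trace_nonneg).1
  rw [← Finset.sum_div]
  refine div_le_of_le_mul₀ hM0 (mul_nonneg (Nat.cast_nonneg _) hM0) ?_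
  calc ∑ j ∈ s, (M * pauli j.1 j.2).trace.re ^ 2
      ≤ ∑ j ∈ s, ‖(M * pauli j.1 j.2).trace‖ ^ 2 := by
        refine Finset.sum_le_sum fun j _ => ?_
        exact sq_le_sq.mpr ((Complex.abs_re_le_norm _).trans_eq (abs_norm _).symm)
    _ ≤ ∑ j : G × AddChar G ℂ, ‖(M * pauli j.1 j.2).trace‖ ^ 2 :=
        Finset.sum_le_univ_sum_of_nonneg fun _ => by positivity
    _ ≤ Fintype.card G * M.trace.re ^ 2 := sum_norm_trace_mul_pauli_sq_le h2 hM
    _ = Fintype.card G * M.trace.re * M.trace.re := by ring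

namespace Procedure

section

variable {A B C Y : Type*} [Fintype B] [Fintype C] [DecidableEq B] [DecidableEq C]
  (P : Procedure A B C Y)

theorem trace_effect_nonneg (y : Y) : 0 ≤ (P.effect y).trace.re :=
  (Complex.nonneg_iff.mp (P.effect_posSemidef y).trace_nonneg).1

theorem hasSum_trace_effect : HasSum (fun y => (P.effect y).trace.re) (Fintype.card B) := by
  simpa using P.hasSum_trace_effect_mul 1

theorem summable_trace_effect_mul_sq_div {O : Matrix B B ℂ} (hO : O.IsHermitian)
    (hO2 : O * O = 1) :
    Summable fun y => (P.effect y * O).trace.re ^ 2 / (P.effect y).trace.re := by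
  refine P.hasSum_trace_effect.summable.of_nonneg_of_le
    (fun y => div_nonneg (sq_nonneg _) (P.trace_effect_nonneg y)) fun y => ?_
  refine div_le_of_le_mul₀ (P.trace_effect_nonneg y) (P.trace_effect_nonneg y) ?_
  have h := abs_le.mp (P.abs_trace_effect_mul_le hO hO2 y)
  rw [← sq]
  exact sq_le_sq' h.1 h.2

/-- Telling the states `(1 ± e O) / d` apart takes many rounds if the POVM is insensitive
to `O`. -/
theorem exists_le_rounds_mul [Fintype A] [DecidableEq A] [Nonempty A] [Nonempty B] [Nonempty C]
    {ε p e : ℝ} (hP : P.Succeeds ε p) (hp : 1 / 2 ≤ p) (hε : 0 < ε) (hεe : ε < e) (he : e ≤ 1)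
    {O : Matrix B B ℂ} (hO : O.IsHermitian) (hO2 : O * O = 1) (htr : O.trace = 0) :
    ∃ T : Task A B C, (2 * p - 1) ^ 2 / 2 ≤ P.rounds T * (e ^ 2 / Fintype.card B *
      ∑' y, (P.effect y * O).trace.re ^ 2 / (P.effect y).trace.re) := by
  obtain ⟨V, l, hl, hV⟩ := exists_unitary_diagonal hO hO2
  obtain ⟨α, hα⟩ := exists_isState (A := A)
  obtain ⟨σ, hσ⟩ := exists_isState (A := C)
  set T : Task A B C := rotationTask V l hl
  refine ⟨T, ?_⟩
  set d : ℝ := (Fintype.card B : ℝ) with hd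
  have hd0 : 0 < d := Nat.cast_pos.mpr Fintype.card_pos
  have he0 : 0 < e := hε.trans hεe
  -- The task measures `O` in its eigenbasis, so the tilt itself is the value to estimate.
  have hval : ∀ s : ℝ, T.value (α ⊗ₖ tilted O s) σ = s := fun s => by
    rw [value_rotationTask V l hl hα _ hσ, ← hV, trace_mul_tilted_self hO2 htr, Complex.ofReal_re]
  have habs : |e| ≤ 1 := by rwa [abs_of_pos he0]
  have hst := isState_tilted hO hO2 htr habs
  have hst' := isState_tilted hO hO2 htr (e := -e) (by rwa [abs_neg])
  set q : Y → ℝ := fun y => (P.effect y).trace.re / d with hq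
  set r : Y → ℝ := fun y => e * ((P.effect y * O).trace.re / d) with hr
  have hq1 : HasSum q 1 := by
    have h := P.hasSum_trace_effect.div_const d
    rwa [← hd, div_self hd0.ne'] at h
  have hr0 : HasSum r 0 := by
    simpa [htr] using ((P.hasSum_trace_effect_mul O).div_const d).mul_left e
  have hrq : ∀ y, |r y| ≤ q y := fun y => by
    rw [hr, hq, abs_mul, abs_div, abs_of_pos hd0]
    have h1 := div_le_div_of_nonneg_right (P.abs_trace_effect_mul_le hO hO2 y) hd0.le
    calc |e| * (|(P.effect y * O).trace.re| / d)
        ≤ 1 * (|(P.effect y * O).trace.re| / d) :=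
          mul_le_mul_of_nonneg_right habs (by positivity)
      _ ≤ _ := by rwa [one_mul]
  have hκ := P.outcomeKernel_nonneg T hα hσ
  have hκ1 := P.sum_outcomeKernel T hα hσ
  have hpos : ∀ w, P.roundProb T (α ⊗ₖ tilted O e) σ w =
      (q w.1 + r w.1) * P.outcomeKernel T α σ w := fun w => by
    rw [P.roundProb_kronecker T α hst.1.isHermitian, trace_effect_mul_tilted]
  have hneg : ∀ w, P.roundProb T (α ⊗ₖ tilted O (-e)) σ w =
      (q w.1 - r w.1) * P.outcomeKernel T α σ w := fun w => by
    rw [P.roundProb_kronecker T α hst'.1.isHermitian, trace_effect_mul_tilted, neg_mul,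
      ← sub_eq_add_neg]
  have hadd : ∀ y, 0 ≤ q y + r y := fun y => by linarith [(abs_le.mp (hrq y)).1]
  have hsub : ∀ y, 0 ≤ q y - r y := fun y => by linarith [(abs_le.mp (hrq y)).2]
  have hS := P.le_tsum_of_succeeds hP T (hα.kronecker hst) hσ
    (fun w => by rw [hpos]; exact mul_nonneg (hadd _) (hκ _))
    (by rw [funext hpos]; exact (hasSum_mul_kernel hadd (hq1.add hr0) hκ hκ1).summable)
  have hT := P.le_tsum_of_succeeds hP T (hα.kronecker hst') hσ
    (fun w => by rw [hneg]; exact mul_nonneg (hsub _) (hκ _))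
    (by rw [funext hneg]; exact (hasSum_mul_kernel hsub (hq1.sub hr0) hκ hκ1).summable)
  simp only [hpos, hval] at hS
  simp only [hneg, hval] at hT
  refine (le_mul_of_test hq1 hrq hr0 hκ hκ1 (P.rounds T) ?_ hp hS hT).trans (le_of_eq ?_)
  · rw [Set.disjoint_left]
    intro ω h1 h2
    have h1' := (abs_le.mp (show |P.estimate T ω - e| ≤ ε from h1)).1
    have h2' := (abs_le.mp (show |P.estimate T ω - -e| ≤ ε from h2)).2
    linarith
  · congr 1
    rw [← tsum_mul_left]
    refine tsum_congr fun y => ?_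
    rw [hr, hq]
    field_simp

/-- Some non-identity Pauli matrix is hardly seen by the POVM. -/
theorem exists_pauli_tsum_le {G : Type*} [AddCommGroup G] [Fintype G] [DecidableEq G]
    [Nontrivial G] (h2 : ∀ x : G, x + x = 0) (P : Procedure A G C Y) :
    ∃ j : G × AddChar G ℂ, j ≠ 0 ∧
      ∑' y, (P.effect y * pauli j.1 j.2).trace.re ^ 2 / (P.effect y).trace.re ≤ 2 := by
  classical
  set d : ℝ := (Fintype.card G : ℝ) with hd
  have hd2 : 2 ≤ d := by
    have : 2 ≤ Fintype.card G := Fintype.one_lt_card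
    rw [hd]; exact_mod_cast this
  set s : Finset (G × AddChar G ℂ) := Finset.univ.erase 0 with hs
  have hcard : (s.card : ℝ) = d ^ 2 - 1 := by
    rw [hs, Finset.card_erase_of_mem (Finset.mem_univ _), Finset.card_univ, Fintype.card_prod,
      AddChar.card_eq, Nat.cast_sub (Nat.mul_pos Fintype.card_pos Fintype.card_pos)]
    push_cast
    ring
  have hsum : ∀ j ∈ s, Summable fun y =>
      (P.effect y * pauli j.1 j.2).trace.re ^ 2 / (P.effect y).trace.re := fun j _ =>
    P.summable_trace_effect_mul_sq_div (isHermitian_pauli h2 _ _) (pauli_mul_self h2 _ _)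
  have htotal : ∑ j ∈ s, ∑' y,
      (P.effect y * pauli j.1 j.2).trace.re ^ 2 / (P.effect y).trace.re ≤ d * d := by
    rw [← Summable.tsum_finsetSum hsum]
    refine hasSum_le (fun y => ?_) (summable_sum hsum).hasSum
      (P.hasSum_trace_effect.mul_left d)
    exact sum_trace_mul_pauli_sq_div_le h2 (P.effect_posSemidef y) s
  -- Otherwise `2 (d² - 1) ≤ d²`, which fails for `d ≥ 2`.
  by_contra! hcon
  have hlt : ∑ j ∈ s, (2 : ℝ) ≤ ∑ j ∈ s, ∑' y,
      (P.effect y * pauli j.1 j.2).trace.re ^ 2 / (P.effect y).trace.re :=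
    Finset.sum_le_sum fun j hj => (hcon j (Finset.ne_of_mem_erase hj)).le
  rw [Finset.sum_const, nsmul_eq_mul, hcard] at hlt
  nlinarith

end

end Procedure

end WireCutting

end

theorem theorem2 (p : ℝ) (hp : 1 / 2 < p) :
    ∃ c : ℝ, 0 < c ∧
      ∀ (k dA dC : ℕ), 1 ≤ k → 0 < dA → 0 < dC →
      ∀ ε : ℝ, 0 < ε → ε < 1 →
      ∀ (Y : Type*) (P : WireCutting.Procedure (Fin dA) (Fin k → Fin 2) (Fin dC) Y),
        P.Succeeds ε p →
        ∃ T : WireCutting.Task (Fin dA) (Fin k → Fin 2) (Fin dC),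
          c * (2 ^ k / ε ^ 2) ≤ (P.rounds T : ℝ) := by
  have hp0 : 0 < 2 * p - 1 := by linarith
  refine ⟨(2 * p - 1) ^ 2 / 16, by positivity, ?_⟩
  intro k dA dC hk hdA hdC ε hε hε1 Y P hP
  have : Nonempty (Fin dA) := ⟨⟨0, hdA⟩⟩
  have : Nonempty (Fin dC) := ⟨⟨0, hdC⟩⟩
  have : Nonempty (Fin k) := ⟨⟨0, hk⟩⟩
  have h2 : ∀ x : Fin k → Fin 2, x + x = 0 := fun x => funext fun i => by
    have : ∀ b : Fin 2, b + b = 0 := by decide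
    exact this (x i)
  obtain ⟨j, hj, hle⟩ := WireCutting.Procedure.exists_pauli_tsum_le h2 P
  -- The tilt `e = min 1 (2ε)` exceeds `ε`, because `ε < 1`, while `(1 ± e O)/d` remain states.
  obtain ⟨T, hT⟩ := P.exists_le_rounds_mul hP hp.le hε
    (lt_min hε1 (by linarith : ε < 2 * ε)) (min_le_left _ _)
    (WireCutting.isHermitian_pauli h2 j.1 j.2) (WireCutting.pauli_mul_self h2 j.1 j.2)
    (WireCutting.trace_pauli hj)
  refine ⟨T, ?_⟩
  have hcard : (Fintype.card (Fin k → Fin 2) : ℝ) = 2 ^ k := by simp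
  rw [hcard] at hT
  set e := min 1 (2 * ε)
  have he0 : 0 < e := lt_min one_pos (by linarith)
  have he : e ^ 2 ≤ (2 * ε) ^ 2 := pow_le_pow_left₀ he0.le (min_le_right _ _) 2
  have hbound : (2 * p - 1) ^ 2 / 2 ≤ P.rounds T * ((2 * ε) ^ 2 / 2 ^ k * 2) := by
    refine hT.trans (mul_le_mul_of_nonneg_left ?_ (Nat.cast_nonneg _))
    exact (mul_le_mul_of_nonneg_left hle (by positivity)).trans
      (mul_le_mul_of_nonneg_right (div_le_div_of_nonneg_right he (by positivity)) (by norm_num))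
  have hk0 : (0 : ℝ) < 2 ^ k := by positivity
  calc (2 * p - 1) ^ 2 / 16 * (2 ^ k / ε ^ 2)
      = (2 * p - 1) ^ 2 / 2 * (2 ^ k / (8 * ε ^ 2)) := by field_simp; norm_num
    _ ≤ P.rounds T * ((2 * ε) ^ 2 / 2 ^ k * 2) * (2 ^ k / (8 * ε ^ 2)) :=
        mul_le_mul_of_nonneg_right hbound (by positivity)
    _ = P.rounds T := by field_simp; norm_num
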